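/- Let $K$ be a number field whose ring of integers is monogenic, $\mathcal{O}_K=\mathbf{Z}[\theta]$. Let $\alpha\in\mathcal{O}_K$ be such that $p=|N_{K/\mathbf{Q}}(\alpha)|$ is a prime number and such that $\alpha$ gives a canonical number system, that is, every element of $\mathcal{O}_K$ is a finite sum $\sum_{i=0}^n c_i\alpha^i$ with integers $0\le c_i\le p-1$. Let $q$ be a positive integer with $q\le|\sigma(\alpha)|$ for every embedding $\sigma:K\to\mathbf{C}$, and with $q<p$ (this last condition is automatic if $K\neq\mathbf{Q}$). Let $\psi:\mathbf{N}\to\mathbf{N}\cup\{+\infty\}$ be admissible, that is, the set $\mathbf{N}_\psi=\{n:\psi(n)\neq+\infty\}$ is either $\mathbf{N}$ or of the form $\{0,\dots,N\}$, and $\psi$ is strictly increasing on $\mathbf{N}_\psi$; let $(a_n)_{n\ge0}$ be a sequence with values in $\{1,\dots,p-1\}$. Put $$G(T)=\sum_{n=0}^{\infty}a_n\alpha^{\psi(n)}T^n\in K[[T]],\qquad \alpha^{+\infty}=0 .$$ Then the series $G(1/q)=\sum_{n\ge 0}a_n\alpha^{\psi(n)}q^{-n}$ converges in the completion $K_\alpha$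 of $K$ at the prime ideal $(\alpha)$, and $G(T)$ is a rational function (an element of $K(T)$) if and only if $G(1/q)\in K$. -/

import Mathlib

open scoped NumberField
open IsDedekindDomain

namespace CollatzCNS

/-- `ψ : ℕ → ℕ ∪ {∞}` is admissible: the set where `ψ` is finite is `{0, …, N}` for some `N`, or all
of `ℕ`, and `ψ` is strictly increasing on it. -/
def IsAdmissible (ψ : ℕ → ℕ∞) : Prop :=
  ((∃ N : ℕ, {n | ψ n ≠ ⊤} = Set.Iic N) ∨ {n | ψ n ≠ ⊤} = Set.univ) ∧
    StrictMonoOn ψ {n | ψ n ≠ ⊤}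

/-- The ring of integers is of the form `ℤ[θ]`. -/
def IsMonogenic (K : Type*) [Field K] : Prop :=
  ∃ θ : 𝓞 K, Algebra.adjoin ℤ {θ} = ⊤

/-- `α` gives a canonical number system: every algebraic integer of `K` is a finite sum
`∑ cᵢ αⁱ` with digits `0 ≤ cᵢ ≤ |N(α)| - 1`. -/
def IsCNS {K : Type*} [Field K] (α : 𝓞 K) : Prop :=
  ∀ x : 𝓞 K, ∃ (n : ℕ) (c : ℕ → ℕ), (∀ i, c i < (Algebra.norm ℤ α).natAbs) ∧
    x = ∑ i ∈ Finset.range (n + 1), (c i : 𝓞 K) * α ^ i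

/-- The finite place of `K` given by the ideal `(α)`, which is prime because its norm is. -/
def place {K : Type*} [Field K] [NumberField K] (α : 𝓞 K)
    (hα : (Algebra.norm ℤ α).natAbs.Prime) : HeightOneSpectrum (𝓞 K) where
  asIdeal := Ideal.span {α}
  isPrime := Ideal.isPrime_of_irreducible_absNorm (by
    rw [Ideal.absNorm_span_singleton]
    exact hα)
  ne_bot := by
    rw [Ne, Ideal.span_singleton_eq_bot]
    rintro rfl
    rw [Algebra.norm_zero] at hα
    exact Nat.not_prime_zero hα

/-- `x ^ m` for `m ∈ ℕ ∪ {∞}`, with `x ^ ∞ = 0`. -/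
noncomputable def powENat {K : Type*} [Field K] (x : K) (m : ℕ∞) : K :=
  if m = ⊤ then 0 else x ^ m.toNat

/-- The power series `G(T) = ∑ aₙ x ^ ψ(n) Tⁿ`. -/
noncomputable def gSeries {K : Type*} [Field K] (x : K) (ψ : ℕ → ℕ∞) (a : ℕ → ℕ) :
    PowerSeries K :=
  PowerSeries.mk fun n => (a n : K) * powENat x (ψ n)

/-- A formal power series is (the expansion of) a rational function. -/
def IsRationalFunction {K : Type*} [Field K] (f : PowerSeries K) : Prop :=
  ∃ P Q : Polynomial K, Q ≠ 0 ∧ (Q : PowerSeries K) * f = (P : PowerSeries K)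

/-- The series `f(x)` converges in the `v`-adic completion `K_v` of `K`, with sum `s`. -/
def HasValueAt {K : Type*} [Field K] [NumberField K] (v : HeightOneSpectrum (𝓞 K))
    (f : PowerSeries K) (x : K) (s : v.adicCompletion K) : Prop :=
  HasSum (fun n : ℕ => algebraMap K (v.adicCompletion K) (PowerSeries.coeff n f * x ^ n)) s

end CollatzCNS

/-! Since `q < p`, `q` is a unit at `(α)`, and `ψ n ≥ n`; so the series converges. A rational `G`
takes a value in `K`: cancel common factors of numerator and denominator, then evaluate.

Conversely, suppose the sum lies in `K`. If `ψ` is eventually infinite, `G` is a polynomial.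
Otherwise the normalized tails `t n` are `(α)`-integral and satisfy `α ^ e n * t (n + 1) = q * (t n
- a n)` with `e n ≥ 1`. Away from `(α)` the recursion creates no new denominators, and in every
embedding it contracts by `q / |σ α| < 1`; so the `t n` take finitely many values
(`exists_orbit_eq`). Moreover `t n` determines `a n` modulo `α`, then `e n` by valuation
(`orbit_step_eq`). Hence the orbit is eventually periodic, which makes `G` rational.

The contraction needs `|σ α| ≠ q`, which follows from the primality of the norm
(`norm_embedding_ne_of_prime`). -/

namespace CollatzCNS

/-! ### Norms and conjugates of `α` -/

section Norm

variable {K : Type*} [Field K] [NumberField K]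

-- The norm is determined by the roots of the minimal polynomial and the degree of `K` over `ℚ(x)`,
-- itself fixed by the degree of that polynomial.
open scoped IntermediateField in
theorem norm_eq_of_minpoly_eq {x y : K} (h : minpoly ℚ x = minpoly ℚ y) :
    Algebra.norm ℚ x = Algebra.norm ℚ y := by
  have hfin : Module.finrank ℚ⟮x⟯ K = Module.finrank ℚ⟮y⟯ K := by
    have hx := Module.finrank_mul_finrank ℚ ℚ⟮x⟯ K
    have hy := Module.finrank_mul_finrank ℚ ℚ⟮y⟯ K
    rw [IntermediateField.adjoin.finrank (Algebra.IsIntegral.isIntegral x)] at hx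
    rw [IntermediateField.adjoin.finrank (Algebra.IsIntegral.isIntegral y), ← h, ← hx] at hy
    exact (Nat.eq_of_mul_eq_mul_left
      (minpoly.natDegree_pos (Algebra.IsIntegral.isIntegral x)) hy).symm
  apply (algebraMap ℚ ℂ).injective
  rw [Algebra.norm_eq_prod_roots ℂ (IsAlgClosed.splits _),
    Algebra.norm_eq_prod_roots ℂ (IsAlgClosed.splits _), h, hfin]

/-- If some conjugate of `α` has rational absolute value `q`, then `N(α)² = q ^ (2 [K : ℚ])`. -/
theorem norm_sq_eq_of_norm_embedding_eq {α : K} {q : ℕ} (hα : α ≠ 0) (σ : K →+* ℂ)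
    (h : ‖σ α‖ = q) : Algebra.norm ℚ α ^ 2 = (q : ℚ) ^ (2 * Module.finrank ℚ K) := by
  have hσα : σ α ≠ 0 := by simpa using hα
  -- The complex conjugate of `σ α` is again the image of an element of `K`, so that element is a
  -- conjugate of `α`.
  have hconj : σ ((q : K) ^ 2 / α) = (starRingEnd ℂ) (σ α) := by
    rw [map_div₀, div_eq_iff hσα, mul_comm, Complex.mul_conj, Complex.normSq_eq_norm_sq, h]
    simp
  have hmin : minpoly ℚ ((q : K) ^ 2 / α) = minpoly ℚ α := by
    rw [← minpoly.algHom_eq σ.toRatAlgHom σ.injective,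
      ← minpoly.algHom_eq (Complex.conjAe.toAlgHom.toRingHom.comp σ).toRatAlgHom
        (RingHom.injective _) α]
    exact congrArg _ hconj
  have hnorm := norm_eq_of_minpoly_eq hmin
  have hmul : Algebra.norm ℚ ((q : K) ^ 2 / α) * Algebra.norm ℚ α
      = (q : ℚ) ^ (2 * Module.finrank ℚ K) := by
    rw [← map_mul, div_mul_cancel₀ _ hα, map_pow, ← map_natCast (algebraMap ℚ K),
      Algebra.norm_algebraMap, ← pow_mul, mul_comm]
  rw [← hmul, hnorm, sq]

theorem ne_zero_of_prime_norm {α : 𝓞 K} (hp : (Algebra.norm ℤ α).natAbs.Prime) : (α : K) ≠ 0 := by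
  rw [Ne, NumberField.RingOfIntegers.coe_eq_zero_iff]
  rintro rfl
  simp [Nat.not_prime_zero] at hp

theorem norm_embedding_ne_of_prime {α : 𝓞 K} (hp : (Algebra.norm ℤ α).natAbs.Prime) {q : ℕ}
    (hqp : q < (Algebra.norm ℤ α).natAbs) (σ : K →+* ℂ) : ‖σ (α : K)‖ ≠ q := by
  intro h
  have hsq := norm_sq_eq_of_norm_embedding_eq (ne_zero_of_prime_norm hp) σ h
  rw [← Algebra.coe_norm_int] at hsq
  have hsq' : (Algebra.norm ℤ α) ^ 2 = (q : ℤ) ^ (2 * Module.finrank ℚ K) := by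
    exact_mod_cast hsq
  have hnat : (Algebra.norm ℤ α).natAbs ^ 2 = (q ^ Module.finrank ℚ K) ^ 2 := by
    have := congrArg Int.natAbs hsq'
    rwa [Int.natAbs_pow, Int.natAbs_pow, Int.natAbs_natCast, mul_comm, pow_mul] at this
  have hpow := Nat.pow_left_injective (two_ne_zero) hnat
  rw [hpow] at hp hqp
  -- A prime of the form `q ^ [K : ℚ]` forces degree one, hence `p = q`.
  rw [hp.eq_one_of_pow, pow_one] at hqp
  exact lt_irrefl _ hqp

theorem norm_dvd_of_dvd_intCast {α : 𝓞 K} (hp : (Algebra.norm ℤ α).natAbs.Prime) {n : ℤ}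
    (h : α ∣ (n : 𝓞 K)) : ((Algebra.norm ℤ α).natAbs : ℤ) ∣ n := by
  have h1 := map_dvd (Algebra.norm ℤ) h
  have h2 : Algebra.norm ℤ (n : 𝓞 K) = n ^ Module.finrank ℤ (𝓞 K) := by
    simpa using Algebra.norm_algebraMap (R := ℤ) (S := 𝓞 K) n
  rw [h2] at h1
  exact (Nat.prime_iff_prime_int.mp hp).dvd_of_dvd_pow (Int.natAbs_dvd.mpr h1)

end Norm

/-! ### Valuations at `(α)` and at the other primes -/

section Place

variable {K : Type*} [Field K] [NumberField K] {α : 𝓞 K} (hp : (Algebra.norm ℤ α).natAbs.Prime)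

theorem valuation_place_self_lt_one : (place α hp).valuation K (α : K) < 1 :=
  (HeightOneSpectrum.valuation_lt_one_iff_mem _ α).mpr (Ideal.mem_span_singleton_self α)

theorem valuation_eq_one_of_ne_place {w : HeightOneSpectrum (𝓞 K)} (hw : w ≠ place α hp) :
    w.valuation K (α : K) = 1 := by
  refine (HeightOneSpectrum.valuation_eq_one_iff_notMem w).mpr fun hmem => hw ?_
  apply HeightOneSpectrum.ext
  have hle : (place α hp).asIdeal ≤ w.asIdeal :=
    (Ideal.span_singleton_le_iff_mem w.asIdeal).mpr hmem
  exact ((place α hp).isMaximal.eq_of_le w.isPrime.ne_top hle).symm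

theorem dvd_of_valuation_place_intCast_lt_one {n : ℤ} (h : (place α hp).valuation K (n : K) < 1) :
    ((Algebra.norm ℤ α).natAbs : ℤ) ∣ n := by
  apply norm_dvd_of_dvd_intCast hp
  rw [← Ideal.mem_span_singleton]
  refine (HeightOneSpectrum.valuation_lt_one_iff_mem (K := K) (place α hp) _).mp ?_
  simpa using h

theorem valuation_natCast_le_one (w : HeightOneSpectrum (𝓞 K)) (n : ℕ) :
    w.valuation K (n : K) ≤ 1 := by
  simpa using w.valuation_le_one (K := K) (n : 𝓞 K)

theorem valuation_place_natCast_eq_one {n : ℕ} (h0 : 0 < n)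
    (hn : n < (Algebra.norm ℤ α).natAbs) : (place α hp).valuation K (n : K) = 1 := by
  refine le_antisymm (valuation_natCast_le_one _ _) (not_lt.mp fun h => ?_)
  have := dvd_of_valuation_place_intCast_lt_one hp (n := n) (by simpa using h)
  exact absurd (Nat.le_of_dvd h0 (Int.natCast_dvd_natCast.mp this)) (not_le.mpr hn)

end Place

/-! ### Finiteness and determinism of the orbit -/

section Orbit

theorem exists_bound_of_contraction {u : ℕ → ℝ} {r c : ℝ} (hr0 : 0 ≤ r) (hr1 : r < 1)
    (h : ∀ n, u (n + 1) ≤ r * (u n + c)) : ∃ B, ∀ n, u n ≤ B := by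
  have h1 : 0 < 1 - r := by linarith
  -- `r * c / (1 - r)` is the fixed point of `u ↦ r * (u + c)`.
  refine ⟨max (u 0) (r * c / (1 - r)), fun n => ?_⟩
  induction n with
  | zero => exact le_max_left _ _
  | succ n ih =>
    refine (h n).trans ?_
    have hm := le_max_right (u 0) (r * c / (1 - r))
    rw [div_le_iff₀ h1] at hm
    nlinarith [mul_le_mul_of_nonneg_left ih hr0]

variable {K : Type*} [Field K] [NumberField K] {α : 𝓞 K} (hp : (Algebra.norm ℤ α).natAbs.Prime)
  {q : ℕ} {a e : ℕ → ℕ} {t : ℕ → K}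

/-- A denominator of `t 0` serves for all terms: `α` is a unit at every place other than `(α)`, and
at `(α)` integrality is assumed. -/
theorem exists_isIntegral_mul_orbit
    (hrec : ∀ n, (α : K) ^ e n * t (n + 1) = q * (t n - a n))
    (ht : ∀ n, (place α hp).valuation K (t n) ≤ 1) :
    ∃ d : 𝓞 K, d ≠ 0 ∧ ∀ n, IsIntegral ℤ ((d : K) * t n) := by
  obtain ⟨⟨x, d⟩, hxd⟩ := IsLocalization.surj (nonZeroDivisors (𝓞 K)) (t 0)
  have hle : ∀ n, ∀ w : HeightOneSpectrum (𝓞 K),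
      w.valuation K (((d : 𝓞 K) : K) * t n) ≤ 1 := by
    intro n w
    by_cases hw : w = place α hp
    · subst hw
      rw [map_mul]
      exact mul_le_one' ((place α hp).valuation_le_one _) (ht n)
    induction n with
    | zero =>
      rw [mul_comm]
      exact hxd ▸ w.valuation_le_one x
    | succ n ih =>
      have h1 : w.valuation K (((d : 𝓞 K) : K) * t (n + 1)) =
          w.valuation K (q * (((d : 𝓞 K) : K) * t n - ((d : 𝓞 K) : K) * a n)) := by
        rw [← mul_sub, mul_left_comm, ← hrec n]
        simp [valuation_eq_one_of_ne_place hp hw]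
      rw [h1, map_mul]
      refine mul_le_one' (valuation_natCast_le_one w q) ((Valuation.map_sub _ _ _).trans ?_)
      refine max_le ih ?_
      rw [map_mul]
      exact mul_le_one' (w.valuation_le_one _) (valuation_natCast_le_one w _)
  refine ⟨d, nonZeroDivisors.coe_ne_zero d, fun n => ?_⟩
  obtain ⟨y, hy⟩ := HeightOneSpectrum.mem_integers_of_valuation_le_one K _ (hle n)
  rw [← hy]
  exact NumberField.RingOfIntegers.isIntegral_coe y

theorem exists_norm_orbit_le {b : ℕ} (hq : 0 < q) (hqα : ∀ σ : K →+* ℂ, (q : ℝ) < ‖σ (α : K)‖)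
    (he : ∀ n, 1 ≤ e n) (ha : ∀ n, a n ≤ b)
    (hrec : ∀ n, (α : K) ^ e n * t (n + 1) = q * (t n - a n)) :
    ∃ B : ℝ, ∀ (σ : K →+* ℂ) (n : ℕ), ‖σ (t n)‖ ≤ B := by
  have hσ : ∀ σ : K →+* ℂ, ∃ B : ℝ, ∀ n, ‖σ (t n)‖ ≤ B := by
    intro σ
    have hpos : (0 : ℝ) < ‖σ (α : K)‖ := lt_of_le_of_lt q.cast_nonneg (hqα σ)
    have hone : (1 : ℝ) ≤ ‖σ (α : K)‖ := le_trans (by exact_mod_cast hq) (hqα σ).le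
    refine exists_bound_of_contraction (r := q / ‖σ (α : K)‖) (c := b) (by positivity)
      ((div_lt_one hpos).mpr (hqα σ)) fun n => ?_
    have h1 : ‖σ (α : K)‖ ^ e n * ‖σ (t (n + 1))‖ = q * ‖σ (t n) - a n‖ := by
      have := congrArg (fun z => ‖σ z‖) (hrec n)
      simpa using this
    have h2 : ‖σ (t n) - a n‖ ≤ ‖σ (t n)‖ + b := by
      refine (norm_sub_le _ _).trans ?_
      gcongr
      simpa using ha n
    have h3 : ‖σ (α : K)‖ ≤ ‖σ (α : K)‖ ^ e n :=
      le_self_pow₀ hone (Nat.one_le_iff_ne_zero.mp (he n))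
    rw [div_mul_eq_mul_div, le_div_iff₀ hpos, mul_comm]
    calc ‖σ (α : K)‖ * ‖σ (t (n + 1))‖ ≤ ‖σ (α : K)‖ ^ e n * ‖σ (t (n + 1))‖ := by gcongr
      _ = q * ‖σ (t n) - a n‖ := h1
      _ ≤ q * (‖σ (t n)‖ + b) := by gcongr
  choose B hB using hσ
  refine ⟨∑ σ, |B σ|, fun σ n => (hB σ n).trans ((le_abs_self _).trans ?_)⟩
  exact Finset.single_le_sum (f := fun σ => |B σ|) (fun _ _ => abs_nonneg _) (Finset.mem_univ σ)

/-- Northcott finiteness: with a common denominator and bounded conjugates, the terms form a finite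
set, so two coincide. -/
theorem exists_orbit_eq {b : ℕ} (hq : 0 < q) (hqα : ∀ σ : K →+* ℂ, (q : ℝ) < ‖σ (α : K)‖)
    (he : ∀ n, 1 ≤ e n) (ha : ∀ n, a n ≤ b)
    (hrec : ∀ n, (α : K) ^ e n * t (n + 1) = q * (t n - a n))
    (ht : ∀ n, (place α hp).valuation K (t n) ≤ 1) :
    ∃ N L, 0 < L ∧ t (N + L) = t N := by
  obtain ⟨d, hd, hint⟩ := exists_isIntegral_mul_orbit hp hrec ht
  obtain ⟨B, hB⟩ := exists_norm_orbit_le hq hqα he ha hrec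
  have hd' : (d : K) ≠ 0 := by simpa using hd
  have hfin := NumberField.Embeddings.finite_of_norm_le K ℂ ((∑ σ : K →+* ℂ, ‖σ (d : K)‖) * B)
  have hmaps : Set.MapsTo (fun n => (d : K) * t n) Set.univ
      {x : K | IsIntegral ℤ x ∧ ∀ σ : K →+* ℂ, ‖σ x‖ ≤ (∑ σ : K →+* ℂ, ‖σ (d : K)‖) * B} := by
    refine fun n _ => ⟨hint n, fun σ => ?_⟩
    rw [map_mul, norm_mul]
    exact mul_le_mul (Finset.single_le_sum (f := fun σ : K →+* ℂ => ‖σ (d : K)‖)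
      (fun _ _ => norm_nonneg _) (Finset.mem_univ σ)) (hB σ n) (norm_nonneg _)
      (Finset.sum_nonneg fun _ _ => norm_nonneg _)
  obtain ⟨m, -, n, -, hmn, hEq⟩ := Set.infinite_univ.exists_lt_map_eq_of_mapsTo hmaps hfin
  refine ⟨m, n - m, Nat.sub_pos_of_lt hmn, ?_⟩
  rw [Nat.add_sub_cancel' hmn.le]
  exact (mul_left_cancel₀ hd' hEq).symm

theorem valuation_orbit_sub_digit_lt_one
    (hq : 0 < q) (hqp : q < (Algebra.norm ℤ α).natAbs)
    (he : ∀ n, 1 ≤ e n)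
    (hrec : ∀ n, (α : K) ^ e n * t (n + 1) = q * (t n - a n))
    (ht : ∀ n, (place α hp).valuation K (t n) ≤ 1)
    (n : ℕ) :
    (place α hp).valuation K (t n - a n) < 1 := by
  have h := congrArg ((place α hp).valuation K) (hrec n)
  rw [map_mul, map_mul, valuation_place_natCast_eq_one hp hq hqp, one_mul, map_pow] at h
  rw [← h]
  exact mul_lt_one_of_lt_of_le
    (pow_lt_one₀ zero_le (valuation_place_self_lt_one hp) (Nat.one_le_iff_ne_zero.mp (he n))) (ht _)

/-- The term is congruent modulo `α` to a nonzero digit, which is a unit there. -/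
theorem valuation_orbit_eq_one
    (hq : 0 < q) (hqp : q < (Algebra.norm ℤ α).natAbs)
    (ha : ∀ n, 1 ≤ a n ∧ a n < (Algebra.norm ℤ α).natAbs)
    (he : ∀ n, 1 ≤ e n)
    (hrec : ∀ n, (α : K) ^ e n * t (n + 1) = q * (t n - a n))
    (ht : ∀ n, (place α hp).valuation K (t n) ≤ 1)
    (n : ℕ) : (place α hp).valuation K (t n) = 1 := by
  have h1 := valuation_orbit_sub_digit_lt_one hp hq hqp he hrec ht n
  have h2 := valuation_place_natCast_eq_one hp (ha n).1 (ha n).2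
  rw [← h2] at h1
  exact (Valuation.map_eq_of_sub_lt _ h1).trans h2

/-- The orbit is deterministic: a term determines its digit, the next exponent and the next
term. -/
theorem orbit_step_eq
    (hq : 0 < q) (hqp : q < (Algebra.norm ℤ α).natAbs)
    (ha : ∀ n, 1 ≤ a n ∧ a n < (Algebra.norm ℤ α).natAbs)
    (he : ∀ n, 1 ≤ e n)
    (hrec : ∀ n, (α : K) ^ e n * t (n + 1) = q * (t n - a n))
    (ht : ∀ n, (place α hp).valuation K (t n) ≤ 1)
    {m n : ℕ} (h : t m = t n) :
    a m = a n ∧ e m = e n ∧ t (m + 1) = t (n + 1) := by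
  have haa : a m = a n := by
    have hm := valuation_orbit_sub_digit_lt_one hp hq hqp he hrec ht m
    have hn := valuation_orbit_sub_digit_lt_one hp hq hqp he hrec ht n
    have hlt : (place α hp).valuation K (((a m : ℤ) - (a n : ℤ) : ℤ) : K) < 1 := by
      have h1 : (((a m : ℤ) - (a n : ℤ) : ℤ) : K) = (t n - a n) - (t m - a m) := by
        push_cast
        rw [h]
        ring
      rw [h1]
      exact (Valuation.map_sub _ _ _).trans_lt (max_lt hn hm)
    have hdvd := dvd_of_valuation_place_intCast_lt_one hp hlt
    -- Both digits lie in `[1, p - 1]`, so a difference divisible by `p` vanishes.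
    have := Int.eq_zero_of_abs_lt_dvd hdvd (by
      have := ha m
      have := ha n
      rw [abs_lt]
      constructor <;> omega)
    omega
  have hα0 := ne_zero_of_prime_norm hp
  have hmul : (α : K) ^ e m * t (m + 1) = (α : K) ^ e n * t (n + 1) := by
    rw [hrec, hrec, h, haa]
  -- The terms are units at `(α)`, so the valuation of each side reveals its exponent.
  have hee : e m = e n := by
    have := congrArg ((place α hp).valuation K) hmul
    rw [map_mul, map_mul, valuation_orbit_eq_one hp hq hqp ha he hrec ht,
      valuation_orbit_eq_one hp hq hqp ha he hrec ht, mul_one, mul_one, map_pow, map_pow] at this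
    exact pow_right_injective₀ (by simpa [zero_lt_iff] using hα0)
      (valuation_place_self_lt_one hp).ne this
  refine ⟨haa, hee, ?_⟩
  rw [hee] at hmul
  exact mul_left_cancel₀ (pow_ne_zero _ hα0) hmul

end Orbit

/-! ### Rational power series and their values -/

section Rational

variable {K : Type*} [Field K]

theorem isRationalFunction_of_coeff_eq_zero {f : PowerSeries K} {Q : Polynomial K} (hQ : Q ≠ 0)
    (N : ℕ) (h : ∀ n, N ≤ n → PowerSeries.coeff n ((Q : PowerSeries K) * f) = 0) :
    IsRationalFunction f := by
  refine ⟨PowerSeries.trunc N ((Q : PowerSeries K) * f), Q, hQ, ?_⟩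
  ext n
  rw [Polynomial.coeff_coe, PowerSeries.coeff_trunc]
  split_ifs with hn
  · rfl
  · exact h n (not_lt.mp hn)

theorem isRationalFunction_of_coeff_add_eq {f : PowerSeries K} {N L : ℕ} (hL : 0 < L) (c : K)
    (h : ∀ n, N ≤ n → PowerSeries.coeff (n + L) f = c * PowerSeries.coeff n f) :
    IsRationalFunction f := by
  refine isRationalFunction_of_coeff_eq_zero
    (Q := 1 - Polynomial.C c * Polynomial.X ^ L) (fun h0 => ?_) (N + L) fun n hn => ?_
  · have := congrArg (Polynomial.coeff · 0) h0
    simp [hL.ne] at this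
  · obtain ⟨m, rfl⟩ := Nat.exists_eq_add_of_le' (le_of_add_le_right hn)
    have hm := h m (by omega)
    simp [sub_mul, mul_assoc, PowerSeries.coeff_X_pow_mul, hm]

variable [NumberField K] {v : HeightOneSpectrum (𝓞 K)}

theorem hasValueAt_one (x : K) : HasValueAt v 1 x 1 := by
  unfold HasValueAt
  convert! hasSum_single (f := fun n : ℕ => algebraMap K (v.adicCompletion K)
    (PowerSeries.coeff n (1 : PowerSeries K) * x ^ n)) 0 ?_ using 1
  · simp
  · intro n hn
    simp [PowerSeries.coeff_one, hn]

theorem HasValueAt.X_mul {f : PowerSeries K} {x : K} {s : v.adicCompletion K}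
    (h : HasValueAt v f x s) :
    HasValueAt v (PowerSeries.X * f) x (algebraMap K (v.adicCompletion K) x * s) := by
  unfold HasValueAt at h ⊢
  rw [← hasSum_nat_add_iff' 1]
  convert! h.mul_left (algebraMap K (v.adicCompletion K) x) using 1
  · ext1 n
    rw [PowerSeries.coeff_succ_X_mul, ← map_mul]
    congr 1
    ring
  · simp

theorem HasValueAt.polynomial_mul {f : PowerSeries K} {x : K} {s : v.adicCompletion K}
    (h : HasValueAt v f x s) (Q : Polynomial K) :
    HasValueAt v ((Q : PowerSeries K) * f) x
      (algebraMap K (v.adicCompletion K) (Q.eval x) * s) := by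
  induction Q using Polynomial.induction_on with
  | C c =>
    unfold HasValueAt at h ⊢
    simpa [mul_assoc] using h.mul_left (algebraMap K (v.adicCompletion K) c)
  | add P Q hP hQ =>
    unfold HasValueAt at hP hQ ⊢
    simpa [add_mul] using hP.add hQ
  | monomial n c ih =>
    convert! ih.X_mul using 1
    · simp [pow_succ]
      ring
    · simp [pow_succ]
      ring

theorem hasValueAt_polynomial (P : Polynomial K) (x : K) :
    HasValueAt v (P : PowerSeries K) x (algebraMap K (v.adicCompletion K) (P.eval x)) := by
  simpa using (hasValueAt_one (v := v) x).polynomial_mul P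

/-- The value of a rational power series at a point of `K` where it converges is in `K`. -/
theorem HasValueAt.mem_range_of_isRationalFunction {f : PowerSeries K} {x : K}
    {s : v.adicCompletion K} (h : HasValueAt v f x s) (hf : IsRationalFunction f) :
    s ∈ Set.range (algebraMap K (v.adicCompletion K)) := by
  obtain ⟨P, Q, hQ, hPQ⟩ := hf
  induction hn : Q.natDegree using Nat.strong_induction_on generalizing P Q with
  | _ n ih =>
  have hval : algebraMap K (v.adicCompletion K) (Q.eval x) * s =
      algebraMap K (v.adicCompletion K) (P.eval x) := by
    have h1 := h.polynomial_mul Q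
    rw [hPQ] at h1
    exact h1.unique (hasValueAt_polynomial P x)
  -- `P` and `Q` need not be coprime: if `Q` vanishes at `x`, so does `P`, and cancelling `X - x`
  -- lowers the degree.
  by_cases hQx : Q.eval x = 0
  · have hPx : P.eval x = 0 := by
      rw [hQx, map_zero, zero_mul] at hval
      exact (map_eq_zero _).mp hval.symm
    obtain ⟨Q₁, rfl⟩ := Polynomial.dvd_iff_isRoot.mpr hQx
    obtain ⟨P₁, rfl⟩ := Polynomial.dvd_iff_isRoot.mpr hPx
    have hX : (Polynomial.X - Polynomial.C x) ≠ 0 := Polynomial.X_sub_C_ne_zero x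
    have hQ₁ : Q₁ ≠ 0 := right_ne_zero_of_mul hQ
    refine ih Q₁.natDegree ?_ P₁ Q₁ hQ₁ ?_ rfl
    · rw [← hn, Polynomial.natDegree_mul hX hQ₁, Polynomial.natDegree_X_sub_C]
      omega
    · rw [Polynomial.coe_mul, Polynomial.coe_mul, mul_assoc] at hPQ
      exact mul_left_cancel₀ (fun h0 => hX (Polynomial.coe_eq_zero_iff.mp h0)) hPQ
  · refine ⟨P.eval x / Q.eval x, ?_⟩
    rw [map_div₀, ← hval, mul_div_cancel_left₀]
    simpa using hQx

end Rational

/-! ### Convergence in the completion -/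

section Completion

variable {K : Type*} [Field K] [NumberField K] {v : HeightOneSpectrum (𝓞 K)}

theorem valued_algebraMap (x : K) :
    Valued.v (algebraMap K (v.adicCompletion K) x) = v.valuation K x :=
  v.valuedAdicCompletion_eq_valuation' x

theorem nonarchimedeanAddGroup_of_valued {R Γ₀ : Type*} [Ring R]
    [LinearOrderedCommGroupWithZero Γ₀] [Valued R Γ₀] : NonarchimedeanAddGroup R where
  is_nonarchimedean U hU := by
    obtain ⟨γ, hγ⟩ := Valued.mem_nhds_zero.mp hU
    exact ⟨⟨Valuation.ltAddSubgroup Valued.v.restrict γ, Valued.isOpen_ball R γ.1⟩, hγ⟩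

/-- A power-series-like sum `∑ uₙ xⁿ` with `v`-integral `uₙ` converges when `v(x) < 1`. -/
theorem summable_of_valuation_le_pow {f : ℕ → K} {x : K} (hx : v.valuation K x < 1)
    (hf : ∀ n, v.valuation K (f n) ≤ v.valuation K x ^ n) :
    Summable fun n => algebraMap K (v.adicCompletion K) (f n) := by
  have := nonarchimedeanAddGroup_of_valued (R := v.adicCompletion K)
  apply NonarchimedeanAddGroup.summable_of_tendsto_cofinite_zero
  rw [Nat.cofinite_eq_atTop]
  have hpow := Valued.tendsto_zero_pow_of_v_lt_one
    (x := algebraMap K (v.adicCompletion K) x) (by rwa [valued_algebraMap])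
  rw [(Valued.hasBasis_nhds_zero _ _).tendsto_right_iff] at hpow ⊢
  intro γ hγ
  filter_upwards [hpow γ hγ] with n hn
  refine lt_of_le_of_lt ?_ hn
  rw [Valuation.restrict_le_iff, map_pow, valued_algebraMap, valued_algebraMap]
  exact hf n

theorem valued_hasSum_le_one {f : ℕ → v.adicCompletion K} {s : v.adicCompletion K}
    (hs : HasSum f s) (hf : ∀ n, Valued.v (f n) ≤ 1) : Valued.v s ≤ 1 := by
  have hcl := Valued.isClosed_integer (v.adicCompletion K)
  refine hcl.mem_of_tendsto hs (Filter.Eventually.of_forall fun F => ?_)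
  exact Subring.sum_mem _ fun n _ => hf n

end Completion

/-! ### The series `G` and its normalized tails -/

section Series

theorem coeff_gSeries {K : Type*} [Field K] (x : K) (ψ : ℕ → ℕ∞) (a : ℕ → ℕ) (n : ℕ) :
    PowerSeries.coeff n (gSeries x ψ a) = (a n : K) * powENat x (ψ n) :=
  PowerSeries.coeff_mk _ _

theorem powENat_natCast {K : Type*} [Field K] (x : K) (m : ℕ) : powENat x (m : ℕ∞) = x ^ m := by
  simp [powENat]

theorem isRationalFunction_gSeries_of_eventually_top {K : Type*} [Field K] (x : K) {ψ : ℕ → ℕ∞}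
    (a : ℕ → ℕ) {N : ℕ} (hψ : {n | ψ n ≠ ⊤} = Set.Iic N) :
    IsRationalFunction (gSeries x ψ a) := by
  refine isRationalFunction_of_coeff_eq_zero (Q := 1) one_ne_zero (N + 1) fun n hn => ?_
  have htop : ψ n = ⊤ := by
    by_contra h
    have : n ∈ Set.Iic N := hψ ▸ h
    exact absurd (Set.mem_Iic.mp this) (by omega)
  simp [coeff_gSeries, htop, powENat]

theorem exists_strictMono_of_finite {ψ : ℕ → ℕ∞} (hmono : StrictMonoOn ψ {n | ψ n ≠ ⊤})
    (h : {n | ψ n ≠ ⊤} = Set.univ) : ∃ φ : ℕ → ℕ, StrictMono φ ∧ ψ = fun n => (φ n : ℕ∞) := by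
  have hfin : ∀ n, ψ n ≠ ⊤ := fun n => (h ▸ Set.mem_univ n : n ∈ {n | ψ n ≠ ⊤})
  choose φ hφ using fun n => ENat.ne_top_iff_exists.mp (hfin n)
  refine ⟨φ, fun m n hmn => ?_, funext fun n => (hφ n).symm⟩
  have := hmono (hfin m) (hfin n) hmn
  rw [← hφ, ← hφ] at this
  exact_mod_cast this

theorem IsAdmissible.natCast_le {ψ : ℕ → ℕ∞} (hψ : IsAdmissible ψ) (n : ℕ) : (n : ℕ∞) ≤ ψ n := by
  by_cases hn : ψ n = ⊤
  · simp [hn]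
  have hlower : ∀ m ≤ n, ψ m ≠ ⊤ := by
    intro m hm
    rcases hψ.1 with ⟨N, hN⟩ | h
    · have hnN : n ∈ Set.Iic N := hN ▸ hn
      exact (hN ▸ Set.mem_Iic.mpr (hm.trans (Set.mem_Iic.mp hnN)) : m ∈ {n | ψ n ≠ ⊤})
    · exact (h ▸ Set.mem_univ m : m ∈ {n | ψ n ≠ ⊤})
  have key : ∀ m ≤ n, (m : ℕ∞) ≤ ψ m := by
    intro m
    induction m with
    | zero => simp
    | succ m ih =>
      intro hm
      have h1 := hψ.2 (hlower m (by omega)) (hlower (m + 1) hm) (Nat.lt_succ_self m)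
      rw [Nat.cast_add, Nat.cast_one]
      exact Order.add_one_le_of_lt ((ih (by omega)).trans_lt h1)
  exact key n le_rfl

/-- The `N`-th tail of the series `∑ aₙ α ^ φ(n) q⁻ⁿ` with sum `s`, divided by
`α ^ φ(N) q ^ (-N)`. -/
noncomputable def normalizedTail {K : Type*} [Field K] (x : K) (q : ℕ) (a φ : ℕ → ℕ) (s : K)
    (N : ℕ) : K :=
  (q : K) ^ N / x ^ φ N * (s - ∑ n ∈ Finset.range N, (a n : K) * x ^ φ n * (1 / (q : K)) ^ n)

theorem normalizedTail_succ {K : Type*} [Field K] [CharZero K] {q : ℕ} {a : ℕ → ℕ} {x : K}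
    (hx : x ≠ 0) (hq : 0 < q) {φ : ℕ → ℕ} (hφ : StrictMono φ) (s : K) (N : ℕ) :
    x ^ (φ (N + 1) - φ N) * normalizedTail x q a φ s (N + 1) =
      q * (normalizedTail x q a φ s N - a N) := by
  have hq' : (q : K) ≠ 0 := by exact_mod_cast hq.ne'
  have hpow : x ^ φ (N + 1) = x ^ (φ (N + 1) - φ N) * x ^ φ N := by
    rw [← pow_add, Nat.sub_add_cancel (hφ (Nat.lt_succ_self N)).le]
  have h1 := pow_ne_zero (φ (N + 1) - φ N) hx
  have h2 := pow_ne_zero (φ N) hx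
  rw [normalizedTail, normalizedTail, Finset.sum_range_succ, hpow, one_div_pow]
  generalize ∑ n ∈ Finset.range N, (a n : K) * x ^ φ n * (1 / (q : K)) ^ n = S
  field_simp
  ring

variable {K : Type*} [Field K] [NumberField K] {α : 𝓞 K} (hp : (Algebra.norm ℤ α).natAbs.Prime)
  {q : ℕ} {a : ℕ → ℕ}

theorem exists_hasValueAt_gSeries
    (hq : 0 < q) (hqp : q < (Algebra.norm ℤ α).natAbs)
    {ψ : ℕ → ℕ∞} (hψ : IsAdmissible ψ) :
    ∃ s, HasValueAt (place α hp) (gSeries (α : K) ψ a) (1 / (q : K)) s := by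
  have hα := valuation_place_self_lt_one (K := K) hp
  refine (summable_of_valuation_le_pow hα fun n => ?_ : Summable _)
  rw [coeff_gSeries, map_mul, map_mul, map_pow, map_div₀,
    valuation_place_natCast_eq_one hp hq hqp, map_one, div_one, one_pow, mul_one]
  refine (mul_le_of_le_one_left' (valuation_natCast_le_one _ _)).trans ?_
  by_cases hn : ψ n = ⊤
  · simp [hn, powENat]
  · obtain ⟨m, hm⟩ := ENat.ne_top_iff_exists.mp hn
    have hle := hψ.natCast_le n
    rw [← hm] at hle
    rw [← hm, powENat_natCast, map_pow]
    exact pow_le_pow_right_of_le_one' hα.le (by exact_mod_cast hle)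

/-- Every term of the tail has exponent at least `φ N`, so it stays integral after division by `α ^
φ N`; the valuation ring is closed. -/
theorem valuation_normalizedTail_le_one
    (hq : 0 < q) (hqp : q < (Algebra.norm ℤ α).natAbs)
    {φ : ℕ → ℕ} (hφ : StrictMono φ) {s : K}
    (hs : HasValueAt (place α hp) (gSeries (α : K) (fun n => (φ n : ℕ∞)) a) (1 / (q : K))
      (algebraMap K _ s)) (N : ℕ) :
    (place α hp).valuation K (normalizedTail (α : K) q a φ s N) ≤ 1 := by
  have hα := valuation_place_self_lt_one (K := K) hp
  have hα0 : (place α hp).valuation K (α : K) ≠ 0 :=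
    (Valuation.ne_zero_iff _).mpr (ne_zero_of_prime_norm hp)
  unfold HasValueAt at hs
  rw [← hasSum_nat_add_iff' N] at hs
  have hs' := hs.mul_left (algebraMap K ((place α hp).adicCompletion K)
    ((q : K) ^ N / (α : K) ^ φ N))
  rw [← map_sum, ← map_sub, ← map_mul] at hs'
  simp only [coeff_gSeries, powENat_natCast] at hs'
  rw [← valued_algebraMap]
  refine valued_hasSum_le_one hs' fun n => ?_
  rw [← map_mul, valued_algebraMap]
  simp only [map_mul, map_pow, map_div₀, valuation_place_natCast_eq_one hp hq hqp, map_inv₀,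
    inv_one, one_pow, mul_one, one_div]
  rw [mul_left_comm]
  refine mul_le_one' (valuation_natCast_le_one _ _) ?_
  rw [inv_mul_le_iff₀ (zero_lt_iff.mpr (pow_ne_zero _ hα0)), mul_one]
  exact pow_le_pow_right_of_le_one' hα.le (hφ.monotone (Nat.le_add_left N n))

/-- If `G(1/q)` is in `K`, the normalized tails take finitely many values, so the digits and the
exponent gaps are eventually periodic and `G` is rational. -/
theorem isRationalFunction_gSeries_of_hasValueAt
    (hq : 0 < q) (hqp : q < (Algebra.norm ℤ α).natAbs)
    (ha : ∀ n, 1 ≤ a n ∧ a n < (Algebra.norm ℤ α).natAbs)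
    (hqα : ∀ σ : K →+* ℂ, (q : ℝ) < ‖σ (α : K)‖) {φ : ℕ → ℕ} (hφ : StrictMono φ) {s : K}
    (hs : HasValueAt (place α hp) (gSeries (α : K) (fun n => (φ n : ℕ∞)) a) (1 / (q : K))
      (algebraMap K _ s)) :
    IsRationalFunction (gSeries (α : K) (fun n => (φ n : ℕ∞)) a) := by
  have hα0 : (α : K) ≠ 0 := ne_zero_of_prime_norm hp
  have he : ∀ n, 1 ≤ φ (n + 1) - φ n := fun n =>
    Nat.le_sub_of_add_le' (hφ (Nat.lt_succ_self n))
  have hrec := normalizedTail_succ (a := a) hα0 hq hφ s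
  have ht := valuation_normalizedTail_le_one hp hq hqp hφ hs
  obtain ⟨N, L, hL, hNL⟩ := exists_orbit_eq hp hq hqα he (fun n => (ha n).2.le) hrec ht
  have hper : ∀ k, normalizedTail (α : K) q a φ s (N + L + k) =
      normalizedTail (α : K) q a φ s (N + k) := by
    intro k
    induction k with
    | zero => exact hNL
    | succ k ih => exact (orbit_step_eq hp hq hqp ha he hrec ht ih).2.2
  have hstep := fun k => orbit_step_eq hp hq hqp ha he hrec ht (hper k)
  -- Periodic gaps make `φ` grow by a constant over each period, so coefficients a period apart
  -- differ by a fixed power of `α`.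
  have hshift : ∀ k, φ (N + L + k) = φ (N + k) + (φ (N + L) - φ N) := by
    intro k
    induction k with
    | zero => exact (Nat.add_sub_cancel' (hφ.monotone (Nat.le_add_right N L))).symm
    | succ k ih =>
      have h1 := (hstep k).2.1
      have h2 := hφ (Nat.lt_succ_self (N + L + k))
      have h3 := hφ (Nat.lt_succ_self (N + k))
      simp only [Nat.succ_eq_add_one, ← add_assoc] at h1 h2 h3 ⊢
      omega
  refine isRationalFunction_of_coeff_add_eq (N := N) hL ((α : K) ^ (φ (N + L) - φ N))
    fun n hn => ?_
  obtain ⟨k, rfl⟩ := Nat.exists_eq_add_of_le hn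
  rw [coeff_gSeries, coeff_gSeries, powENat_natCast, powENat_natCast, add_right_comm, hshift,
    (hstep k).1]
  ring

end Series

end CollatzCNS

theorem mainTheorem9 (K : Type*) [Field K] [NumberField K]
    (hK : CollatzCNS.IsMonogenic K)
    (α : 𝓞 K) (hα : CollatzCNS.IsCNS α)
    (hp : (Algebra.norm ℤ α).natAbs.Prime)
    (p : ℕ) (hpα : p = (Algebra.norm ℤ α).natAbs)
    (q : ℕ) (hq : 0 < q) (hqp : q < p)
    (hqα : ∀ σ : K →+* ℂ, (q : ℝ) ≤ ‖σ (α : K)‖)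
    (ψ : ℕ → ℕ∞) (hψ : CollatzCNS.IsAdmissible ψ)
    (a : ℕ → ℕ) (ha : ∀ n, 1 ≤ a n ∧ a n ≤ p - 1) :
    ∃ s : (CollatzCNS.place α hp).adicCompletion K,
      CollatzCNS.HasValueAt (CollatzCNS.place α hp)
        (CollatzCNS.gSeries (α : K) ψ a) (1 / (q : K)) s ∧
      (CollatzCNS.IsRationalFunction (CollatzCNS.gSeries (α : K) ψ a) ↔
        s ∈ Set.range (algebraMap K ((CollatzCNS.place α hp).adicCompletion K))) := by
  subst hpα
  obtain ⟨s, hs⟩ := CollatzCNS.exists_hasValueAt_gSeries (a := a) hp hq hqp hψ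
  refine ⟨s, hs, hs.mem_range_of_isRationalFunction, ?_⟩
  rintro ⟨x, rfl⟩
  rcases hψ.1 with ⟨N, hN⟩ | huniv
  · exact CollatzCNS.isRationalFunction_gSeries_of_eventually_top _ _ hN
  · obtain ⟨φ, hφ, rfl⟩ := CollatzCNS.exists_strictMono_of_finite hψ.2 huniv
    exact CollatzCNS.isRationalFunction_gSeries_of_hasValueAt hp hq hqp
      (fun n => ⟨(ha n).1, by have := ha n; have := hp.pos; omega⟩)
      (fun σ => lt_of_le_of_ne (hqα σ) (CollatzCNS.norm_embedding_ne_of_prime hp hqp σ).symm)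
      hφ hs
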